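/- Let $\widetilde L\subset\mathbb R^d\times\mathbb R^m$ be a lattice (a discrete subgroup of full rank), let $|\det\widetilde L|$ be the volume of its fundamental domain, and let $\pi_1,\pi_2$ be the projections onto $\mathbb R^d$ and $\mathbb R^m$. Assume that $\pi_1$ and $\pi_2$ are both one-to-one on $\widetilde L$ and that $\pi_1(\widetilde L)$ and $\pi_2(\widetilde L)$ are dense in $\mathbb R^d$ and $\mathbb R^m$, respectively. Put $L=\pi_1(\widetilde L)$ and, for $x\in L$, let $x^\star\in\mathbb R^m$ be the unique point with $(x,x^\star)\in\widetilde L$. Let $(\widetilde L)^*=\{y\in\mathbb R^d\times\mathbb R^m : y\cdot x\in\mathbb Z\text{ for all }x\in\widetilde L\}$ be the dual lattice and $L^*=\pi_1((\widetilde L)^*)$; the projection $\pi_1$ is one-to-one on $(\widetilde L)^*$, and for $k\in L^*$ let $k^\star\in\mathbb R^m$ be the unique point with $(k,k^\star)\in(\widetilde L)^*$. Let $B_r(a)\subset\mathbb R^d$ be the closed ball of radius $r$ centered at $a$. Let $f:\mathbb R^m\to\mathbb C$ be continuous with $|x|^{m+1+\alpha}|f(x)|\le C$ for all $x\in\mathbb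 R^m$, for some constants $C>0$ and $\alpha>0$. Then $f$ is integrable, and for all $k,a\in\mathbb R^d$ and $r>0$ the sum $$c_r(k)=\frac{1}{\operatorname{vol}(B_r(0))}\sum_{x\in L\cap B_r(a)}f(x^\star)\,e^{-2\pi i k\cdot x}$$ converges absolutely. For every $k\in\mathbb R^d$ the Fourier--Bohr coefficient $c(k)=\lim_{r\to\infty}c_r(k)$ exists for every $a\in\mathbb R^d$ and does not depend on $a$. If $k\in L^*$, then $$c(k)=\frac{1}{|\det\widetilde L|}\int_{\mathbb R^m}e^{2\pi i k^\star\cdot u}f(u)\,du=\frac{1}{|\det\widetilde L|}\,\widehat f(-k^\star),\qquad \widehat f(y)=\int_{\mathbb R^m}e^{-2\pi i y\cdot u}f(u)\,du,$$ and if $k\notin L^*$, then $c(k)=0$. -/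

import Mathlib

open MeasureTheory Filter Topology
open scoped FourierTransform

noncomputable section

namespace CutProject

/-- Euclidean space `ℝⁿ`. -/
abbrev Euc (n : ℕ) : Type := EuclideanSpace ℝ (Fin n)

variable {d m : ℕ}

/-- The image `π₁(Λ)` of a subgroup `Λ` of `ℝᵈ × ℝᵐ` under the projection to `ℝᵈ`. -/
def directModule (Λ : Submodule ℤ (Euc d × Euc m)) : Submodule ℤ (Euc d) :=
  Λ.map (LinearMap.fst ℤ (Euc d) (Euc m))

theorem exists_internal (Λ : Submodule ℤ (Euc d × Euc m)) (x : directModule Λ) :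
    ∃ y : Euc m, ((x : Euc d), y) ∈ Λ := by
  obtain ⟨x, hx⟩ := x
  obtain ⟨p, hp, rfl⟩ := Submodule.mem_map.1 hx
  exact ⟨p.2, hp⟩

/-- The star-map `π₂ ∘ (π₁|_Λ)⁻¹ : π₁(Λ) → ℝᵐ`: it sends `x` to the `y` with `(x, y) ∈ Λ`, which
is unique when `π₁|_Λ` is one-to-one (see `starMap_eq`). -/
def starMap (Λ : Submodule ℤ (Euc d × Euc m)) (x : directModule Λ) : Euc m :=
  (exists_internal Λ x).choose

theorem mk_starMap_mem (Λ : Submodule ℤ (Euc d × Euc m)) (x : directModule Λ) :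
    ((x : Euc d), starMap Λ x) ∈ Λ :=
  (exists_internal Λ x).choose_spec

theorem starMap_eq {Λ : Submodule ℤ (Euc d × Euc m)}
    (h : Set.InjOn Prod.fst (Λ : Set (Euc d × Euc m))) (x : directModule Λ) {y : Euc m}
    (hy : ((x : Euc d), y) ∈ Λ) : starMap Λ x = y :=
  congrArg Prod.snd (h (mk_starMap_mem Λ x) hy rfl)

/-- The dual lattice: all `y ∈ ℝᵈ × ℝᵐ` with `y · x ∈ ℤ` for all `x ∈ Λ`, where `·` is the
Euclidean scalar product of `ℝᵈ × ℝᵐ`. -/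
def dualLattice (Λ : Submodule ℤ (Euc d × Euc m)) : Submodule ℤ (Euc d × Euc m) where
  carrier := {y | ∀ x ∈ Λ, ∃ n : ℤ, inner ℝ y.1 x.1 + inner ℝ y.2 x.2 = (n : ℝ)}
  zero_mem' := fun x _ => ⟨0, by simp⟩
  add_mem' := by
    intro y z hy hz x hx
    obtain ⟨n, hn⟩ := hy x hx
    obtain ⟨l, hl⟩ := hz x hx
    refine ⟨n + l, ?_⟩
    push_cast
    rw [← hn, ← hl, Prod.fst_add, Prod.snd_add, inner_add_left, inner_add_left]
    ring
  smul_mem' := by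
    intro c y hy x hx
    obtain ⟨n, hn⟩ := hy x hx
    refine ⟨c * n, ?_⟩
    push_cast
    rw [← hn, Prod.smul_fst, Prod.smul_snd, ← Int.cast_smul_eq_zsmul ℝ c y.1,
      ← Int.cast_smul_eq_zsmul ℝ c y.2, real_inner_smul_left, real_inner_smul_left]
    ring

/-- If `π₂(Λ)` is dense, then `π₁` is one-to-one on the dual lattice, so that the star-map of the
dual lattice is well defined. -/
theorem injOn_fst_dualLattice {Λ : Submodule ℤ (Euc d × Euc m)}
    (h : Dense (Prod.snd '' (Λ : Set (Euc d × Euc m)))) :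
    Set.InjOn Prod.fst (dualLattice Λ : Set (Euc d × Euc m)) := by
  intro y hy z hz hyz
  have hsub : y - z ∈ dualLattice Λ := sub_mem hy hz
  have hfst : (y - z).1 = 0 := by simp [hyz]
  have hint : ∀ v : Euc m, ∃ n : ℤ, inner ℝ (y - z).2 v = (n : ℝ) := by
    intro v
    have hcl : IsClosed {v : Euc m | inner ℝ (y - z).2 v ∈ Set.range ((↑) : ℤ → ℝ)} :=
      Int.isClosedEmbedding_coe_real.isClosed_range.preimage (by fun_prop)
    have hall : Prod.snd '' (Λ : Set (Euc d × Euc m)) ⊆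
        {v : Euc m | inner ℝ (y - z).2 v ∈ Set.range ((↑) : ℤ → ℝ)} := by
      rintro _ ⟨x, hx, rfl⟩
      obtain ⟨n, hn⟩ := hsub x hx
      rw [hfst, inner_zero_left, zero_add] at hn
      exact ⟨n, hn.symm⟩
    obtain ⟨n, hn⟩ := closure_minimal hall hcl (h v)
    exact ⟨n, hn.symm⟩
  have hzero : (y - z).2 = 0 := by
    by_contra hne
    have hq : inner ℝ (y - z).2 (y - z).2 ≠ 0 := fun h0 => hne (inner_self_eq_zero.1 h0)
    obtain ⟨n, hn⟩ := hint ((2 * inner ℝ (y - z).2 (y - z).2)⁻¹ • (y - z).2)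
    rw [real_inner_smul_right] at hn
    have h2 : (2 * n : ℝ) = 1 := by
      rw [← hn]
      field_simp
    have h3 : 2 * n = 1 := by exact_mod_cast h2
    omega
  exact sub_eq_zero.1 (Prod.ext hfst hzero)

/-- The term `f(x^⋆) e^{-2πi k·x}`, for `x ∈ π₁(Λ)`. -/
def bohrTerm (Λ : Submodule ℤ (Euc d × Euc m)) (f : Euc m → ℂ) (k : Euc d)
    (x : directModule Λ) : ℂ :=
  f (starMap Λ x) * Complex.exp (-(2 * Real.pi * Complex.I * (inner ℝ k (x : Euc d) : ℝ)))

/-- The points of `π₁(Λ)` in the closed ball of radius `r` around `a`. -/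
def pointsInBall (Λ : Submodule ℤ (Euc d × Euc m)) (a : Euc d) (r : ℝ) :
    Set (directModule Λ) :=
  {x | (x : Euc d) ∈ Metric.closedBall a r}

/-- The finite volume approximation
`c_r(k) = vol(B_r(0))⁻¹ ∑_{x ∈ π₁(Λ) ∩ B_r(a)} f(x^⋆) e^{-2πi k·x}`. -/
def bohrApprox (Λ : Submodule ℤ (Euc d × Euc m)) (f : Euc m → ℂ) (k a : Euc d) (r : ℝ) : ℂ :=
  (((volume (Metric.closedBall (0 : Euc d) r)).toReal : ℂ))⁻¹ *
    ∑' x : pointsInBall Λ a r, bohrTerm Λ f k x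

end CutProject

end

/-!
Convolving the indicator of the ball with a mollifier `φ` turns the sum over `L ∩ B_r(a)` into the
integral over `B_r(a)` of a smoothed density. As `f` decays, the density has bounded mass, so the
error is of the order of the volume of a shell around the sphere and disappears after division by
the volume of the ball. The density is `t ↦ e^{-2πi k·t} H(t, 0)`, where `H` is the periodization
over the lattice of `(x, u) ↦ e^{-2πi k·x} φ(x) f(u)`, a continuous periodic function on
`ℝᵈ × ℝᵐ`. Such a function is a uniform limit of trigonometric polynomials with frequencies `y` in
the dual lattice, and the mean of `t ↦ e^{-2πi k·t} e^{2πi y·(t, 0)}` vanishes unless `y₁ = k`.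
Hence the limit is `0` for `k ∉ L*`; for `k ∈ L*` it is the Fourier coefficient of `H` at the unique
`y = (k, k⋆)`, which unfolds to an integral over `ℝᵈ × ℝᵐ`.
-/

noncomputable section

namespace CutProject

open Metric
open scoped BoundedContinuousFunction NNReal ENNReal

section Shell

variable {X : Type*} [PseudoMetricSpace X]

/-- A neighbourhood of the sphere of radius `r` around `a`, of width about `ρ`. It contains every
point at which a perturbation by less than `ρ` can change membership in the ball. -/
def shell (a : X) (r ρ : ℝ) : Set X :=
  closedBall a (r + ρ) \ closedBall a (r - ρ)

theorem measurableSet_shell [MeasurableSpace X] [OpensMeasurableSpace X] (a : X) (r ρ : ℝ) :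
    MeasurableSet (shell a r ρ) :=
  measurableSet_closedBall.diff measurableSet_closedBall

theorem measure_shell_lt_top [MeasurableSpace X] [ProperSpace X] {μ : Measure X}
    [IsFiniteMeasureOnCompacts μ] (a : X) (r ρ : ℝ) : μ (shell a r ρ) < ⊤ :=
  (measure_mono Set.sdiff_subset).trans_lt measure_closedBall_lt_top

theorem abs_indicator_closedBall_sub_le {a x y : X} {r ρ : ℝ} (h : dist x y < ρ) :
    |(closedBall a r).indicator (1 : X → ℝ) x - (closedBall a r).indicator 1 y| ≤
      (shell a r ρ).indicator 1 y := by
  have h₁ := dist_triangle x y a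
  have h₂ := dist_triangle y x a
  rw [dist_comm y x] at h₂
  simp only [Set.indicator, shell, Set.mem_sdiff, mem_closedBall, Pi.one_apply]
  split_ifs <;> first | linarith | (norm_num; done) | (exfalso; grind)

end Shell

section SetAverage

variable {X : Type*} [TopologicalSpace X] [MeasurableSpace X] {μ : Measure X} {s : Set X}

theorem norm_setAverage_le (hs : μ s < ⊤) (g : X →ᵇ ℂ) : ‖⨍ x in s, g x ∂μ‖ ≤ ‖g‖ := by
  have hle : ‖∫ x in s, g x ∂μ‖ ≤ ‖g‖ * μ.real s :=
    norm_setIntegral_le_of_norm_le_const hs fun x _ => g.norm_coe_le_norm x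
  have hinv : (μ.real s)⁻¹ * μ.real s ≤ 1 := inv_mul_le_one
  calc ‖⨍ x in s, g x ∂μ‖ = (μ.real s)⁻¹ * ‖∫ x in s, g x ∂μ‖ := by
        rw [setAverage_eq, norm_smul, norm_inv, Real.norm_of_nonneg measureReal_nonneg]
    _ ≤ (μ.real s)⁻¹ * (‖g‖ * μ.real s) := by gcongr
    _ = (μ.real s)⁻¹ * μ.real s * ‖g‖ := by ring
    _ ≤ ‖g‖ := mul_le_of_le_one_left (norm_nonneg g) hinv

variable [OpensMeasurableSpace X]

theorem integrableOn_boundedContinuousFunction (hs : μ s < ⊤) (g : X →ᵇ ℂ) : IntegrableOn g s μ :=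
  haveI : IsFiniteMeasure (μ.restrict s) := ⟨by simpa using hs⟩
  g.integrable _

/-- The average over a set of finite measure, as a functional on bounded continuous functions. -/
def setAverageCLM (hs : μ s < ⊤) : (X →ᵇ ℂ) →L[ℂ] ℂ :=
  LinearMap.mkContinuous
    { toFun := fun g => ⨍ x in s, g x ∂μ
      map_add' := fun g h => by
        simp [setAverage_eq, integral_add (integrableOn_boundedContinuousFunction hs g)
          (integrableOn_boundedContinuousFunction hs h)]
      map_smul' := fun c g => by
        simp [setAverage_eq, integral_const_mul, mul_left_comm] }
    1 fun g => by simpa using norm_setAverage_le hs g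

theorem lipschitzWith_setAverage (hs : μ s < ⊤) :
    LipschitzWith 1 fun g : X →ᵇ ℂ => ⨍ x in s, g x ∂μ :=
  (setAverageCLM hs).lipschitz.weaken (LinearMap.mkContinuous_norm_le _ zero_le_one _)

end SetAverage

section BallMean

variable {V : Type*} [NormedAddCommGroup V] [NormedSpace ℝ V] [FiniteDimensional ℝ V]
  [MeasurableSpace V] (μ : Measure V) [μ.IsAddHaarMeasure]

/-- The averages of `g` over the balls around any fixed centre tend to `c` as the radius grows. -/
def HasBallMean (g : V → ℂ) (c : ℂ) : Prop :=
  ∀ a, Tendsto (fun r => ⨍ t in closedBall a r, g t ∂μ) atTop (𝓝 c)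

theorem hasBallMean_const (c : ℂ) : HasBallMean μ (fun _ => c) c := fun a =>
  tendsto_const_nhds.congr' <| by
    filter_upwards [eventually_gt_atTop 0] with r hr
    rw [setAverage_const (measure_closedBall_pos μ a hr).ne' measure_closedBall_lt_top.ne]

variable [BorelSpace V]

theorem tendsto_measureReal_shell_div (a : V) {ρ : ℝ} (hρ : 0 ≤ ρ) :
    Tendsto (fun r => μ.real (shell a r ρ) / μ.real (closedBall a r)) atTop (𝓝 0) := by
  set n := Module.finrank ℝ V
  have h₀ : Tendsto (fun r : ℝ => ρ / r) atTop (𝓝 0) := tendsto_const_nhds.div_atTop tendsto_id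
  have h₁ : Tendsto (fun r : ℝ => (1 + ρ / r) ^ n - (1 - ρ / r) ^ n) atTop (𝓝 0) := by
    simpa using ((h₀.const_add 1).pow n).sub ((h₀.const_sub 1).pow n)
  refine h₁.congr' ?_
  filter_upwards [eventually_gt_atTop 0, eventually_ge_atTop ρ] with r hr hρr
  have hball : μ.real (ball 0 1 : Set V) ≠ 0 :=
    (ENNReal.toReal_pos (measure_ball_pos μ _ one_pos).ne' measure_ball_lt_top.ne).ne'
  rw [shell, measureReal_sdiff (closedBall_subset_closedBall (by linarith))
    measurableSet_closedBall measure_closedBall_lt_top.ne,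
    Measure.addHaar_real_closedBall μ a (by linarith),
    Measure.addHaar_real_closedBall μ a (by linarith), Measure.addHaar_real_closedBall μ a hr.le,
    ← sub_mul, mul_div_mul_right _ _ hball, sub_div, ← div_pow, ← div_pow, add_div, sub_div,
    div_self hr.ne']

/-- The graph of the mean value functional on bounded continuous functions. -/
def ballMeanGraph : Submodule ℂ ((V →ᵇ ℂ) × ℂ) where
  carrier := {p | HasBallMean μ p.1 p.2}
  zero_mem' a := by simp
  add_mem' {p q} hp hq a :=
    ((hp a).add (hq a)).congr fun r =>
      (map_add (setAverageCLM (μ := μ) (measure_closedBall_lt_top (x := a) (r := r))) p.1 q.1).symm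
  smul_mem' z p hp a :=
    ((hp a).const_smul z).congr fun r =>
      (map_smul (setAverageCLM (μ := μ) (measure_closedBall_lt_top (x := a) (r := r))) z p.1).symm

theorem mem_ballMeanGraph {p : (V →ᵇ ℂ) × ℂ} : p ∈ ballMeanGraph μ ↔ HasBallMean μ p.1 p.2 :=
  Iff.rfl

theorem isClosed_ballMeanGraph : IsClosed (ballMeanGraph μ : Set ((V →ᵇ ℂ) × ℂ)) := by
  have hset : (ballMeanGraph μ : Set ((V →ᵇ ℂ) × ℂ)) =
      ⋂ a, {p | Tendsto (fun r => ⨍ t in closedBall a r, p.1 t ∂μ) atTop (𝓝 p.2)} := by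
    ext p
    simp only [SetLike.mem_coe, mem_ballMeanGraph, HasBallMean, Set.mem_iInter, Set.mem_ofPred_eq]
  rw [hset]
  refine isClosed_iInter fun a => ?_
  have hlip : ∀ r, LipschitzWith 1 fun p : (V →ᵇ ℂ) × ℂ => ⨍ t in closedBall a r, p.1 t ∂μ :=
    fun r => by
      simpa only [mul_one, Function.comp_def] using
        (lipschitzWith_setAverage measure_closedBall_lt_top).comp LipschitzWith.prod_fst
  exact (LipschitzWith.uniformEquicontinuous _ 1 hlip).equicontinuous.isClosed_setOfPred_tendsto
    continuous_snd

theorem norm_setIntegral_closedBall_sub_comp_add_le (g : V →ᵇ ℂ) (a w : V) {r ρ : ℝ}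
    (hw : ‖w‖ < ρ) :
    ‖∫ t in closedBall a r, (g t - g (t + w)) ∂μ‖ ≤ ‖g‖ * μ.real (shell a r ρ) := by
  set B := closedBall a r
  have hB : IsCompact B := isCompact_closedBall a r
  have hBm : MeasurableSet B := measurableSet_closedBall
  have hint : IntegrableOn g B μ := g.continuous.continuousOn.integrableOn_compact hB
  have hint' : IntegrableOn (fun t => g (t + w)) B μ :=
    Continuous.continuousOn (by fun_prop) |>.integrableOn_compact hB
  have hshift : ∫ t in B, g (t + w) ∂μ = ∫ t, B.indicator (fun s => g (s + w)) (t - w) ∂μ := by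
    rw [integral_sub_right_eq_self (B.indicator fun s => g (s + w)) w, integral_indicator hBm]
  have hdiff : ∀ t, B.indicator g t - B.indicator (fun s => g (s + w)) (t - w) =
      (B.indicator (1 : V → ℝ) t - B.indicator (1 : V → ℝ) (t - w)) • g t := fun t => by
    by_cases h₁ : t ∈ B <;> by_cases h₂ : t - w ∈ B <;> simp [h₁, h₂]
  have hbound : ∀ t, ‖B.indicator g t - B.indicator (fun s => g (s + w)) (t - w)‖ ≤
      (shell a r ρ).indicator (fun _ => ‖g‖) t := fun t => by
    have hdist : dist (t - w) t < ρ := by simpa using hw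
    rw [hdiff, norm_smul, Real.norm_eq_abs, abs_sub_comm]
    refine (mul_le_mul (abs_indicator_closedBall_sub_le hdist) (g.norm_coe_le_norm t)
      (norm_nonneg _) (Set.indicator_nonneg (fun _ _ => zero_le_one) _)).trans_eq ?_
    by_cases h : t ∈ shell a r ρ <;> simp [h]
  rw [integral_sub hint hint', hshift, ← integral_indicator hBm, ← integral_sub
    (hint.integrable_indicator hBm) ((hint'.integrable_indicator hBm).comp_sub_right w)]
  refine (norm_integral_le_of_norm_le (IntegrableOn.integrable_indicator
    (integrableOn_const (measure_shell_lt_top a r ρ).ne) (measurableSet_shell a r ρ))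
    (ae_of_all _ hbound)).trans_eq ?_
  rw [integral_indicator (measurableSet_shell a r ρ), setIntegral_const, smul_eq_mul, mul_comm]

theorem hasBallMean_sub_comp_add (g : V →ᵇ ℂ) (w : V) :
    HasBallMean μ (fun t => g t - g (t + w)) 0 := fun a => by
  have hρ : ‖w‖ < ‖w‖ + 1 := lt_add_one _
  have hlim := (tendsto_measureReal_shell_div μ a (ρ := ‖w‖ + 1) (by positivity)).const_mul ‖g‖
  rw [mul_zero] at hlim
  refine squeeze_zero_norm (fun r => ?_) hlim
  rw [setAverage_eq, norm_smul, norm_inv, Real.norm_of_nonneg measureReal_nonneg, inv_mul_eq_div,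
    ← mul_div_assoc]
  gcongr
  exact norm_setIntegral_closedBall_sub_comp_add_le μ g a w hρ

end BallMean

section Characters

variable {E : Type*} [NormedAddCommGroup E] [NormedSpace ℝ E]

/-- The character `z ↦ exp (2πi ξ z)` of `E` with frequency `ξ`, as a bounded continuous
function. -/
def expChar (ξ : StrongDual ℝ E) : E →ᵇ ℂ :=
  BoundedContinuousFunction.char Real.continuous_fourierChar
    (L := isBoundedBilinearMap_apply.symm.toContinuousLinearMap.toLinearMap₁₂)
    isBoundedBilinearMap_apply.symm.continuous ξ

theorem expChar_apply (ξ : StrongDual ℝ E) (z : E) : expChar ξ z = (𝐞 (ξ z) : ℂ) := rfl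

theorem expChar_zero : expChar (0 : StrongDual ℝ E) = 1 :=
  BoundedContinuousFunction.ext fun z => by simp [expChar_apply]

theorem expChar_add (ξ η : StrongDual ℝ E) : expChar (ξ + η) = expChar ξ * expChar η :=
  BoundedContinuousFunction.char_add_eq_mul ξ η

theorem expChar_apply_add (ξ : StrongDual ℝ E) (z w : E) :
    expChar ξ (z + w) = expChar ξ z * expChar ξ w := by
  simp only [expChar_apply, map_add, AddChar.map_add_eq_mul, Circle.coe_mul]

theorem norm_expChar_apply (ξ : StrongDual ℝ E) (z : E) : ‖expChar ξ z‖ = 1 :=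
  Circle.norm_coe _

theorem expChar_apply_eq_one {ξ : StrongDual ℝ E} {z : E} (h : ∃ n : ℤ, ξ z = n) :
    expChar ξ z = 1 := by
  obtain ⟨n, hn⟩ := h
  rw [expChar_apply, hn, Real.fourierChar_apply, ← Complex.exp_int_mul_two_pi_mul_I n]
  congr 1
  push_cast
  ring

theorem exists_expChar_apply_eq_neg_one {ξ : StrongDual ℝ E} (hξ : ξ ≠ 0) :
    ∃ w, expChar ξ w = -1 := by
  obtain ⟨v, hv⟩ := DFunLike.ne_iff.1 hξ
  rw [zero_apply] at hv
  have hhalf : ξ ((2 * ξ v)⁻¹ • v) = 1 / 2 := by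
    rw [map_smul, smul_eq_mul]
    field_simp
  refine ⟨(2 * ξ v)⁻¹ • v, ?_⟩
  rw [expChar_apply, hhalf, Real.fourierChar_apply, ← Complex.exp_pi_mul_I]
  congr 1
  push_cast
  ring

open Classical in
theorem hasBallMean_expChar [FiniteDimensional ℝ E] [MeasurableSpace E] [BorelSpace E]
    (μ : Measure E) [μ.IsAddHaarMeasure] (ξ : StrongDual ℝ E) :
    HasBallMean μ (expChar ξ) (if ξ = 0 then 1 else 0) := by
  split_ifs with hξ
  · rw [hξ, expChar_zero]
    exact hasBallMean_const μ 1
  · obtain ⟨w, hw⟩ := exists_expChar_apply_eq_neg_one hξ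
    have hmean : HasBallMean μ ((2 : ℂ) • expChar ξ : E →ᵇ ℂ) 0 := by
      convert hasBallMean_sub_comp_add μ (expChar ξ) w using 1
      ext t
      simp [expChar_apply_add, hw, two_mul]
    simpa [mem_ballMeanGraph] using
      (ballMeanGraph μ).smul_mem (2⁻¹ : ℂ) (x := ((2 : ℂ) • expChar ξ, 0)) hmean

theorem expChar_innerSL_apply {V : Type*} [NormedAddCommGroup V] [InnerProductSpace ℝ V]
    (y z : V) :
    expChar (innerSL ℝ y) z = Complex.exp (2 * Real.pi * Complex.I * (inner ℝ y z : ℝ)) := by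
  rw [expChar_apply, innerSL_apply_apply, Real.fourierChar_apply]
  congr 1
  push_cast
  ring

end Characters

section LatticeCharacters

variable {E : Type*} [NormedAddCommGroup E] [NormedSpace ℝ E]

/-- The lattice of functionals that are integer valued on `L`, i.e. the dual lattice of `L` inside
the dual space. -/
def integralDual (L : Submodule ℤ E) : AddSubgroup (StrongDual ℝ E) where
  carrier := {ξ | ∀ l ∈ L, ∃ n : ℤ, ξ l = n}
  zero_mem' l _ := ⟨0, by simp⟩
  add_mem' {ξ η} hξ hη l hl := by
    obtain ⟨m, hm⟩ := hξ l hl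
    obtain ⟨n, hn⟩ := hη l hl
    exact ⟨m + n, by simp [hm, hn]⟩
  neg_mem' {ξ} hξ l hl := by
    obtain ⟨n, hn⟩ := hξ l hl
    exact ⟨-n, by simp [hn]⟩

theorem expChar_apply_lattice {L : Submodule ℤ E} {ξ : StrongDual ℝ E} (hξ : ξ ∈ integralDual L)
    (l : L) : expChar ξ l = 1 :=
  expChar_apply_eq_one (hξ l l.2)

variable [FiniteDimensional ℝ E] (L : Submodule ℤ E) [DiscreteTopology L] [IsZLattice ℝ L]

/-- A basis of `E` that is also a `ℤ`-basis of the lattice `L`. -/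
def latticeBasis : Module.Basis (Module.Free.ChooseBasisIndex ℤ L) ℝ E :=
  (Module.Free.chooseBasis ℤ L).ofZLatticeBasis ℝ L

/-- The projection of `E` onto the torus `E ⧸ L`, in the coordinates of `latticeBasis L`. -/
def torusProj : C(E, UnitAddTorus (Module.Free.ChooseBasisIndex ℤ L)) :=
  ⟨fun z i => (((latticeBasis L).equivFunL z i : ℝ) : UnitAddCircle), by fun_prop⟩

theorem isQuotientMap_torusProj : IsQuotientMap (torusProj L) :=
  ((IsOpenQuotientMap.piMap fun _ => QuotientAddGroup.isOpenQuotientMap_mk).comp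
    (latticeBasis L).equivFunL.toHomeomorph.isOpenQuotientMap).isQuotientMap

variable {L}

theorem exists_eq_add_of_torusProj_eq {z w : E} (h : torusProj L z = torusProj L w) :
    ∃ l : L, z = w + l := by
  have hint : ∀ i, ∃ n : ℤ, (latticeBasis L).repr z i = (latticeBasis L).repr w i + n := fun i => by
    have hi : ((latticeBasis L).repr z i : UnitAddCircle) = (latticeBasis L).repr w i :=
      congrFun h i
    rw [← sub_eq_zero, ← AddCircle.coe_sub, AddCircle.coe_eq_zero_iff] at hi
    obtain ⟨n, hn⟩ := hi
    exact ⟨n, by simp only [zsmul_eq_mul, mul_one] at hn; linarith⟩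
  choose n hn using hint
  refine ⟨∑ i, n i • Module.Free.chooseBasis ℤ L i, ?_⟩
  have hcoe : ((∑ i, n i • Module.Free.chooseBasis ℤ L i : L) : E) =
      ∑ i, (n i : ℝ) • latticeBasis L i := by
    simp only [Submodule.coe_sum, Submodule.coe_smul, Int.cast_smul_eq_zsmul, latticeBasis,
      Module.Basis.ofZLatticeBasis_apply]
  calc z = ∑ i, (latticeBasis L).repr z i • latticeBasis L i := ((latticeBasis L).sum_repr z).symm
    _ = ∑ i, (latticeBasis L).repr w i • latticeBasis L i + ∑ i, (n i : ℝ) • latticeBasis L i := by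
      simp only [hn, add_smul, Finset.sum_add_distrib]
    _ = w + (∑ i, n i • Module.Free.chooseBasis ℤ L i : L) := by
      rw [(latticeBasis L).sum_repr, hcoe]

theorem exists_integralDual_mFourier_comp_torusProj (n : Module.Free.ChooseBasisIndex ℤ L → ℤ) :
    ∃ ξ ∈ integralDual L, ∀ z, UnitAddTorus.mFourier n (torusProj L z) = expChar ξ z := by
  set ξ : StrongDual ℝ E := (∑ i, (n i : ℝ) • (latticeBasis L).coord i).toContinuousLinearMap
  have hξ : ∀ z, ξ z = ∑ i, n i * (latticeBasis L).repr z i := fun z => by simp [ξ]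
  refine ⟨ξ, fun l hl => ⟨∑ i, n i * (Module.Free.chooseBasis ℤ L).repr ⟨l, hl⟩ i, ?_⟩,
    fun z => ?_⟩
  · rw [hξ]
    push_cast
    exact Finset.sum_congr rfl fun i _ => by
      rw [← Module.Basis.ofZLatticeBasis_repr_apply ℝ L _ ⟨l, hl⟩ i]; rfl
  · rw [expChar_apply, hξ, Real.fourierChar_apply]
    simp only [UnitAddTorus.mFourier, ContinuousMap.coe_mk, torusProj, fourier_coe_apply,
      ← Complex.exp_sum]
    congr 1
    push_cast
    rw [Finset.mul_sum, Finset.sum_mul]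
    refine Finset.sum_congr rfl fun i _ => ?_
    simp only [Module.Basis.equivFunL_apply, div_one]
    ring

open BoundedContinuousFunction in
theorem mem_closure_span_expChar {H : E →ᵇ ℂ} (hH : ∀ z, ∀ l : L, H (z + l) = H z) :
    H ∈ (Submodule.span ℂ
      (expChar '' (integralDual L : Set (StrongDual ℝ E)))).topologicalClosure := by
  obtain ⟨T, hT⟩ : ∃ T : C(UnitAddTorus _, ℂ), T.comp (torusProj L) = H.toContinuousMap :=
    ⟨(isQuotientMap_torusProj L).lift H.toContinuousMap fun z w hzw => by
      obtain ⟨l, rfl⟩ := exists_eq_add_of_torusProj_eq hzw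
      exact hH w l, IsQuotientMap.lift_comp _ _ _⟩
  set toBounded := (ContinuousMap.linearIsometryBoundedOfCompact
    (UnitAddTorus (Module.Free.ChooseBasisIndex ℤ L)) ℂ ℂ).toContinuousLinearEquiv
  set pullback := (compContinuousCLM ℂ ℂ (torusProj L)).comp toBounded.toContinuousLinearMap
  have hHT : pullback T = H := BoundedContinuousFunction.ext fun z => DFunLike.congr_fun hT z
  have hspan : (Submodule.span ℂ (Set.range UnitAddTorus.mFourier)).map pullback.toLinearMap ≤
      Submodule.span ℂ (expChar '' (integralDual L : Set (StrongDual ℝ E))) := by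
    rw [Submodule.map_span, Submodule.span_le]
    rintro _ ⟨_, ⟨n, rfl⟩, rfl⟩
    obtain ⟨ξ, hξ, hn⟩ := exists_integralDual_mFourier_comp_torusProj (L := L) n
    exact Submodule.subset_span ⟨ξ, hξ, BoundedContinuousFunction.ext fun z => (hn z).symm⟩
  have hTcl : T ∈ (Submodule.span ℂ (Set.range UnitAddTorus.mFourier)).topologicalClosure := by
    rw [UnitAddTorus.span_mFourier_closure_eq_top]
    trivial
  rw [← hHT]
  exact Submodule.topologicalClosure_mono hspan
    (Submodule.topologicalClosure_map (f := pullback) _ (Submodule.mem_map_of_mem hTcl))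

end LatticeCharacters

section FourierCoefficients

variable {E : Type*} [NormedAddCommGroup E] [NormedSpace ℝ E] [FiniteDimensional ℝ E]
  {L : Submodule ℤ E} [DiscreteTopology L] [IsZLattice ℝ L]

open Classical BoundedContinuousFunction in
/-- Both sides are linear and continuous in `H`, so it suffices to compare them on characters. -/
theorem hasBallMean_expChar_mul_comp {V : Type*} [NormedAddCommGroup V] [NormedSpace ℝ V]
    [FiniteDimensional ℝ V] [MeasurableSpace V] [BorelSpace V] {μ : Measure V} [μ.IsAddHaarMeasure]
    (ι : V →L[ℝ] E) (η : StrongDual ℝ V) {Φ : (E →ᵇ ℂ) →L[ℂ] ℂ}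
    (hΦ : ∀ ξ ∈ integralDual L, Φ (expChar ξ) = if ξ.comp ι = η then 1 else 0)
    {H : E →ᵇ ℂ} (hH : ∀ z, ∀ l : L, H (z + l) = H z) :
    HasBallMean μ (fun t => expChar (-η) t * H (ι t)) (Φ H) := by
  set twist : (E →ᵇ ℂ) →L[ℂ] (V →ᵇ ℂ) := (ContinuousLinearMap.mul ℂ _ (expChar (-η))).comp
    (compContinuousCLM ℂ ℂ ⟨ι, ι.continuous⟩)
  set S := (ballMeanGraph μ).comap (twist.prod Φ).toLinearMap
  have hS : IsClosed (S : Set (E →ᵇ ℂ)) :=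
    (isClosed_ballMeanGraph μ).preimage (twist.prod Φ).continuous
  have hspan : Submodule.span ℂ (expChar '' (integralDual L : Set (StrongDual ℝ E))) ≤ S := by
    rw [Submodule.span_le]
    rintro _ ⟨ξ, hξ, rfl⟩
    have htwist : twist (expChar ξ) = expChar (ξ.comp ι - η) := by
      rw [sub_eq_neg_add, expChar_add]
      rfl
    simpa [S, mem_ballMeanGraph, htwist, hΦ ξ hξ, sub_eq_zero] using
      hasBallMean_expChar μ (ξ.comp ι - η)
  exact Submodule.topologicalClosure_minimal _ hspan hS (mem_closure_span_expChar hH)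

variable (L) in
/-- A bounded fundamental domain of `L`: the parallelepiped spanned by `latticeBasis L`. -/
def fundDomain : Set E := ZSpan.fundamentalDomain (latticeBasis L)

variable (L) in
theorem isBounded_fundDomain : Bornology.IsBounded (fundDomain L) :=
  ZSpan.fundamentalDomain_isBounded _

variable [MeasurableSpace E]

variable (L) in
theorem measure_fundDomain_lt_top {μ : Measure E} [IsFiniteMeasureOnCompacts μ] :
    μ (fundDomain L) < ⊤ :=
  (isBounded_fundDomain L).measure_lt_top

variable [BorelSpace E]

instance : MeasurableVAdd L E := inferInstanceAs (MeasurableVAdd L.toAddSubgroup E)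

variable (L) in
theorem isAddFundamentalDomain_fundDomain (μ : Measure E) :
    IsAddFundamentalDomain L (fundDomain L) μ :=
  ZLattice.isAddFundamentalDomain _ μ

variable (L) in
theorem measurableSet_fundDomain : MeasurableSet (fundDomain L) :=
  ZSpan.fundamentalDomain_measurableSet _

variable {μ : Measure E} [μ.IsAddHaarMeasure]

instance : VAddInvariantMeasure L E μ :=
  inferInstanceAs (VAddInvariantMeasure L.toAddSubgroup E μ)

variable (L) in
theorem measure_fundDomain_ne_zero : μ (fundDomain L) ≠ 0 :=
  ZSpan.measure_fundamentalDomain_ne_zero _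

open scoped Pointwise in
theorem setIntegral_fundDomain_comp_add {g : E → ℂ} (hg : ∀ z, ∀ l : L, g (z + l) = g z) (w : E) :
    ∫ z in fundDomain L, g (z + w) ∂μ = ∫ z in fundDomain L, g z ∂μ := by
  have hF := isAddFundamentalDomain_fundDomain L μ
  have hpre : (fun z => z + w) ⁻¹' (w +ᵥ fundDomain L) = fundDomain L := by
    ext z
    simp [Set.mem_vadd_set, add_comm z w]
  rw [hF.setIntegral_eq (hF.vadd_of_comm w) (f := g) fun l z => by
      rw [Submodule.vadd_def, vadd_eq_add, add_comm, hg],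
    ← (measurePreserving_add_right μ w).setIntegral_preimage_emb
      (measurableEmbedding_addRight w) _ (w +ᵥ fundDomain L), hpre]

open Classical in
theorem setAverage_fundDomain_expChar {ξ : StrongDual ℝ E} (hξ : ξ ∈ integralDual L) :
    ⨍ z in fundDomain L, expChar ξ z ∂μ = if ξ = 0 then 1 else 0 := by
  split_ifs with hξ0
  · simpa [hξ0, expChar_zero] using
      setAverage_const (measure_fundDomain_ne_zero L) (measure_fundDomain_lt_top L).ne (1 : ℂ)
  · obtain ⟨w, hw⟩ := exists_expChar_apply_eq_neg_one hξ0
    have hshift := setIntegral_fundDomain_comp_add (μ := μ) (L := L) (g := expChar ξ)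
      (fun z l => by rw [expChar_apply_add, expChar_apply_lattice hξ, mul_one]) w
    simp only [expChar_apply_add, hw, mul_neg_one, integral_neg] at hshift
    rw [setAverage_eq, self_eq_neg.1 hshift.symm, smul_zero]

variable (L μ) in
/-- The Fourier coefficient of an `L`-periodic function at the frequency `ξ`. -/
def fourierCoeffCLM (ξ : StrongDual ℝ E) : (E →ᵇ ℂ) →L[ℂ] ℂ :=
  (setAverageCLM (measure_fundDomain_lt_top (μ := μ) L)).comp
    (ContinuousLinearMap.mul ℂ _ (expChar (-ξ)))

theorem fourierCoeffCLM_apply (ξ : StrongDual ℝ E) (H : E →ᵇ ℂ) :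
    fourierCoeffCLM L μ ξ H = ⨍ z in fundDomain L, expChar (-ξ) z * H z ∂μ :=
  rfl

open Classical in
theorem fourierCoeffCLM_expChar {ξ η : StrongDual ℝ E} (hξ : ξ ∈ integralDual L)
    (hη : η ∈ integralDual L) : fourierCoeffCLM L μ ξ (expChar η) = if η = ξ then 1 else 0 := by
  have hdiff : fourierCoeffCLM L μ ξ (expChar η) = ⨍ z in fundDomain L, expChar (η - ξ) z ∂μ := by
    rw [sub_eq_neg_add, expChar_add]
    rfl
  rw [hdiff, setAverage_fundDomain_expChar (sub_mem hη hξ)]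
  simp only [sub_eq_zero]

end FourierCoefficients

section Periodization

theorem tsum_lattice_sub_add {E α : Type*} [AddCommGroup E] {L : Submodule ℤ E} [AddCommMonoid α]
    [TopologicalSpace α] (q : E → α) (z : E) (l₀ : L) :
    ∑' l : L, q (l - (z + l₀)) = ∑' l : L, q (l - z) := by
  rw [← (Equiv.subRight l₀).tsum_eq fun l : L => q (l - z)]
  simp [sub_sub, add_comm]

variable {E : Type*} [NormedAddCommGroup E] [NormedSpace ℝ E] [FiniteDimensional ℝ E]
  {L : Submodule ℤ E} [DiscreteTopology L] [IsZLattice ℝ L]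

theorem exists_add_mem_fundDomain (z : E) : ∃ l : L, z + l ∈ fundDomain L := by
  obtain ⟨v, hv, -⟩ := ZSpan.exist_unique_vadd_mem_fundamentalDomain (latticeBasis L) z
  refine ⟨⟨v, ((Module.Free.chooseBasis ℤ L).ofZLatticeBasis_span ℝ).le v.2⟩, ?_⟩
  rwa [Submodule.vadd_def, vadd_eq_add, add_comm] at hv

variable [MeasurableSpace E] [BorelSpace E] {μ : Measure E} [μ.IsAddHaarMeasure]
  {G : Type*} [NormedAddCommGroup G] [NormedSpace ℝ G]

open scoped Pointwise in
variable (L) in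
theorem hasSum_setIntegral_fundDomain {g : E → G} (hg : Integrable g μ) :
    HasSum (fun l : L => ∫ z in fundDomain L, g (l - z) ∂μ) (∫ z, g z ∂μ) := by
  have hF := isAddFundamentalDomain_fundDomain L μ
  have hsum := hasSum_integral_measure (f := fun z => g (-z))
    (μ := fun l : L => μ.restrict (l +ᵥ fundDomain L)) (by rw [hF.sum_restrict]; exact hg.comp_neg)
  rw [hF.sum_restrict, integral_neg_eq_self] at hsum
  rw [← (Equiv.neg L).hasSum_iff]
  convert hsum using 2 with l
  rw [← Set.image_vadd, (measurePreserving_vadd l μ).setIntegral_image_emb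
    (measurableEmbedding_const_vadd l)]
  simp [Submodule.vadd_def, sub_eq_neg_add, add_comm]

variable (L) in
theorem setIntegral_fundDomain_tsum {g : E → G} (hg : Integrable g μ) :
    ∫ z in fundDomain L, ∑' l : L, g (l - z) ∂μ = ∫ z, g z ∂μ := by
  have hint := hasSum_integral_of_summable_integral_norm (μ := μ.restrict (fundDomain L))
    (F := fun (l : L) z => g (l - z)) (fun l => (hg.comp_sub_left _).integrableOn)
    (hasSum_setIntegral_fundDomain L hg.norm).summable
  exact hint.unique (hasSum_setIntegral_fundDomain L hg)

end Periodization

section Wiener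

variable {E : Type*} [NormedAddCommGroup E] [MeasurableSpace E]

/-- The Wiener algebra of continuous functions whose local maximal functions are integrable; it is
the natural domain of periodization over a lattice. -/
structure IsWiener (μ : Measure E) (q : E → ℂ) : Prop where
  continuous : Continuous q
  exists_integrable_bound :
    ∀ R : ℝ, ∃ J : E → ℝ, Integrable J μ ∧ ∀ z w, ‖w‖ ≤ R → ‖q (z + w)‖ ≤ J z

variable {μ : Measure E} {q : E → ℂ}

theorem IsWiener.integrable [OpensMeasurableSpace E] (hq : IsWiener μ q) : Integrable q μ := by
  obtain ⟨J, hJ, hqJ⟩ := hq.exists_integrable_bound 0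
  exact hJ.mono' hq.continuous.aestronglyMeasurable
    (ae_of_all _ fun z => by simpa using hqJ z 0 (by simp))

theorem IsWiener.mul_prod {F : Type*} [NormedAddCommGroup F] [MeasurableSpace F] {ν : Measure F}
    {p : F → ℂ} (hq : IsWiener μ q) (hp : IsWiener ν p) :
    IsWiener (μ.prod ν) fun z => q z.1 * p z.2 where
  continuous := (hq.continuous.comp continuous_fst).mul (hp.continuous.comp continuous_snd)
  exists_integrable_bound R := by
    obtain ⟨J, hJ, hqJ⟩ := hq.exists_integrable_bound R
    obtain ⟨K, hK, hpK⟩ := hp.exists_integrable_bound R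
    refine ⟨fun z => J z.1 * K z.2, hJ.mul_prod hK, fun z w hw => ?_⟩
    have hq' := hqJ z.1 w.1 ((norm_fst_le w).trans hw)
    rw [norm_mul]
    exact mul_le_mul hq' (hpK z.2 w.2 ((norm_snd_le w).trans hw)) (norm_nonneg _)
      ((norm_nonneg _).trans hq')

variable [NormedSpace ℝ E] [FiniteDimensional ℝ E] [BorelSpace E] [μ.IsAddHaarMeasure]

theorem isWiener_of_norm_le_one_add_rpow (hq : Continuous q) {s M : ℝ}
    (hs : Module.finrank ℝ E < s) (hM : ∀ z, ‖q z‖ ≤ M * (1 + ‖z‖) ^ (-s)) : IsWiener μ q where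
  continuous := hq
  exists_integrable_bound R := by
    have hM₀ : 0 ≤ M := by simpa using (norm_nonneg _).trans (hM 0)
    refine ⟨fun z => M * ((1 + |R|) ^ s * (1 + ‖z‖) ^ (-s)),
      ((integrable_one_add_norm hs).const_mul _).const_mul M, fun z w hw => (hM _).trans ?_⟩
    have hs₀ : 0 ≤ s := (Nat.cast_nonneg _).trans hs.le
    have hle : 1 + ‖z‖ ≤ (1 + |R|) * (1 + ‖z + w‖) := by
      have htri : ‖z‖ ≤ ‖z + w‖ + ‖w‖ := by simpa using norm_sub_le (z + w) w
      nlinarith [le_abs_self R, abs_nonneg R, norm_nonneg (z + w)]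
    have hpow : (1 + ‖z‖) ^ s ≤ (1 + |R|) ^ s * (1 + ‖z + w‖) ^ s := by
      rw [← Real.mul_rpow (by positivity) (by positivity)]
      exact Real.rpow_le_rpow (by positivity) hle hs₀
    refine mul_le_mul_of_nonneg_left ?_ hM₀
    rwa [Real.rpow_neg (by positivity), Real.rpow_neg (by positivity), inv_eq_one_div,
      ← div_eq_mul_inv, div_le_div_iff₀ (by positivity) (by positivity), one_mul]

theorem isWiener_of_decay (hq : Continuous q) {s C : ℝ} (hs : Module.finrank ℝ E < s)
    (hC : ∀ z, ‖z‖ ^ s * ‖q z‖ ≤ C) : IsWiener μ q := by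
  obtain ⟨M, hM⟩ := (isCompact_closedBall (0 : E) 1).exists_bound_of_continuousOn hq.continuousOn
  have hs₀ : 0 ≤ s := (Nat.cast_nonneg _).trans hs.le
  have hM₀ : 0 ≤ M := (norm_nonneg _).trans (hM 0 (by simp))
  have hC₀ : 0 ≤ C := (by positivity : 0 ≤ ‖(0 : E)‖ ^ s * ‖q 0‖).trans (hC 0)
  refine isWiener_of_norm_le_one_add_rpow hq hs (M := 2 ^ s * (M + C)) fun z => ?_
  rw [Real.rpow_neg (by positivity), ← div_eq_mul_inv, le_div_iff₀ (by positivity)]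
  rcases le_total ‖z‖ 1 with hz | hz
  · calc ‖q z‖ * (1 + ‖z‖) ^ s ≤ (M + C) * 2 ^ s := by
          gcongr
          · linarith [hM z (by simpa using hz)]
          · linarith
      _ = 2 ^ s * (M + C) := mul_comm _ _
  · calc ‖q z‖ * (1 + ‖z‖) ^ s ≤ ‖q z‖ * (2 * ‖z‖) ^ s := by
          gcongr
          linarith
      _ = 2 ^ s * (‖z‖ ^ s * ‖q z‖) := by
          rw [Real.mul_rpow (by positivity) (by positivity)]
          ring
      _ ≤ 2 ^ s * (M + C) := by
          gcongr
          linarith [hC z]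

theorem isWiener_of_hasCompactSupport (hq : Continuous q) (hsupp : HasCompactSupport q) :
    IsWiener μ q := by
  set s : ℝ := Module.finrank ℝ E + 1
  have hcont : Continuous fun z => ‖z‖ ^ s * ‖q z‖ :=
    (continuous_norm.rpow_const fun _ => Or.inr (by positivity)).mul hq.norm
  obtain ⟨C, hC⟩ := hsupp.norm.mul_left.exists_bound_of_continuous hcont
  exact isWiener_of_decay hq (lt_add_one _) fun z => (Real.le_norm_self _).trans (hC z)

variable {L : Submodule ℤ E} [DiscreteTopology L] [IsZLattice ℝ L]

variable (L) in
theorem IsWiener.exists_summable_bound (hq : IsWiener μ q) (R : ℝ) :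
    ∃ u : L → ℝ, Summable u ∧ ∀ (l : L) w, ‖w‖ ≤ R → ‖q (l + w)‖ ≤ u l := by
  obtain ⟨R₀, hR₀⟩ := (isBounded_fundDomain L).exists_norm_le
  obtain ⟨J, hJ, hqJ⟩ := hq.exists_integrable_bound (R₀ + R)
  have hF := measure_fundDomain_lt_top (μ := μ) L
  have hF₀ : 0 < μ.real (fundDomain L) := ENNReal.toReal_pos (measure_fundDomain_ne_zero L) hF.ne
  refine ⟨fun l => (μ.real (fundDomain L))⁻¹ * ∫ z in fundDomain L, J (l - z) ∂μ,
    (hasSum_setIntegral_fundDomain L hJ).summable.mul_left _, fun l w hw => ?_⟩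
  rw [le_inv_mul_iff₀ hF₀, ← smul_eq_mul, ← setIntegral_const]
  refine setIntegral_mono_on (integrableOn_const hF.ne) (hJ.comp_sub_left _).integrableOn
    (measurableSet_fundDomain L) fun z hz => ?_
  simpa [← add_assoc] using hqJ (l - z) (z + w) ((norm_add_le z w).trans (add_le_add (hR₀ z hz) hw))

variable (L) in
theorem IsWiener.exists_tsum_enorm_le (hq : IsWiener μ q) :
    ∃ K : ℝ≥0, ∀ z, ∑' l : L, ‖q (l - z)‖ₑ ≤ K := by
  obtain ⟨R, hR⟩ := (isBounded_fundDomain L).exists_norm_le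
  obtain ⟨u, hu, hqu⟩ := hq.exists_summable_bound L R
  refine ⟨(∑' l, ENNReal.ofReal (u l)).toNNReal, fun z => ?_⟩
  rw [ENNReal.coe_toNNReal hu.tsum_ofReal_ne_top]
  obtain ⟨l₀, hl₀⟩ := exists_add_mem_fundDomain (L := L) z
  rw [← tsum_lattice_sub_add (fun z => ‖q z‖ₑ) z l₀]
  refine ENNReal.tsum_le_tsum fun l => ?_
  rw [← ofReal_norm, sub_eq_add_neg]
  exact ENNReal.ofReal_le_ofReal (hqu l _ (by simpa only [norm_neg] using hR _ hl₀))

variable (L) in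
theorem IsWiener.continuous_tsum (hq : IsWiener μ q) : Continuous fun z => ∑' l : L, q (l - z) := by
  refine continuous_iff_continuousAt.2 fun z => ?_
  obtain ⟨u, hu, hqu⟩ := hq.exists_summable_bound L (‖z‖ + 1)
  have hon : ContinuousOn (fun z => ∑' l : L, q (l - z)) (ball z 1) := by
    refine continuousOn_tsum (fun l => (hq.continuous.comp (by fun_prop)).continuousOn) hu
      fun l w hw => ?_
    rw [sub_eq_add_neg]
    refine hqu l _ ?_
    rw [norm_neg]
    linarith [norm_le_norm_add_norm_sub z w, mem_ball_iff_norm'.1 hw]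
  exact hon.continuousAt (ball_mem_nhds z one_pos)

variable (L) in
/-- The periodization `z ↦ ∑ q (l - z)` of a function in the Wiener algebra. -/
def IsWiener.periodization (hq : IsWiener μ q) : E →ᵇ ℂ :=
  BoundedContinuousFunction.ofNormedAddCommGroup (fun z => ∑' l : L, q (l - z))
    (hq.continuous_tsum L) (hq.exists_tsum_enorm_le L).choose fun z => by
      exact_mod_cast enorm_le_coe.1
        (enorm_tsum_le_tsum_enorm.trans ((hq.exists_tsum_enorm_le L).choose_spec z))

theorem IsWiener.periodization_apply (hq : IsWiener μ q) (z : E) :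
    hq.periodization L z = ∑' l : L, q (l - z) :=
  rfl

theorem IsWiener.periodization_add (hq : IsWiener μ q) (z : E) (l : L) :
    hq.periodization L (z + l) = hq.periodization L z :=
  tsum_lattice_sub_add q z l

theorem IsWiener.fourierCoeffCLM_periodization (hq : IsWiener μ q) {ξ : StrongDual ℝ E}
    (hξ : ξ ∈ integralDual L) :
    fourierCoeffCLM L μ ξ (hq.periodization L) =
      (ZLattice.covolume L μ : ℂ)⁻¹ * ∫ z, expChar ξ z * q z ∂μ := by
  have hint : Integrable (fun z => expChar ξ z * q z) μ :=
    hq.integrable.bdd_mul (expChar ξ).continuous.aestronglyMeasurable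
      (ae_of_all _ fun z => (norm_expChar_apply ξ z).le)
  have hterm : ∀ z, expChar (-ξ) z * hq.periodization L z =
      ∑' l : L, expChar ξ (l - z) * q (l - z) := fun z => by
    have hchar : ∀ l : L, expChar ξ (l - z) = expChar (-ξ) z := fun l => by
      rw [sub_eq_add_neg, expChar_apply_add, expChar_apply_lattice hξ, one_mul, expChar_apply,
        expChar_apply, map_neg, neg_apply]
    simp only [hchar, hq.periodization_apply, tsum_mul_left]
  rw [fourierCoeffCLM_apply, setAverage_eq,
    ← ZLattice.covolume_eq_measure_fundamentalDomain L μ (isAddFundamentalDomain_fundDomain L μ)]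
  simp only [hterm]
  rw [setIntegral_fundDomain_tsum L hint, Complex.real_smul, Complex.ofReal_inv]

end Wiener

section Smoothing

variable {V : Type*} [NormedAddCommGroup V] [NormedSpace ℝ V] [FiniteDimensional ℝ V]
  [MeasurableSpace V] {μ : Measure V} (φ : ContDiffBump (0 : V))

theorem setIntegral_normed_sub_nonneg (x : V) (A : Set V) :
    0 ≤ ∫ t in A, φ.normed μ (x - t) ∂μ :=
  integral_nonneg fun _ => φ.nonneg_normed _

variable [BorelSpace V] [μ.IsAddHaarMeasure]

theorem integrable_normed_sub (x : V) : Integrable (fun t => φ.normed μ (x - t)) μ :=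
  φ.integrable_normed.comp_sub_left x

theorem abs_indicator_closedBall_sub_setIntegral_le (a x : V) (r : ℝ) :
    |(closedBall a r).indicator (1 : V → ℝ) x - ∫ t in closedBall a r, φ.normed μ (x - t) ∂μ| ≤
      ∫ t in shell a r φ.rOut, φ.normed μ (x - t) ∂μ := by
  have hφ := integrable_normed_sub (μ := μ) φ x
  have hB : MeasurableSet (closedBall a r) := measurableSet_closedBall
  have hS := measurableSet_shell a r φ.rOut
  have hind : ∀ (s : Set V) t, s.indicator (fun t => φ.normed μ (x - t)) t =
      φ.normed μ (x - t) * s.indicator 1 t := fun s t => by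
    simp only [Set.indicator, Pi.one_apply, mul_ite, mul_one, mul_zero]
  have hmass : (closedBall a r).indicator (1 : V → ℝ) x =
      ∫ t, φ.normed μ (x - t) * (closedBall a r).indicator 1 x ∂μ := by
    rw [integral_mul_const, integral_sub_left_eq_self, φ.integral_normed, one_mul]
  rw [hmass, ← integral_indicator hB, ← integral_indicator hS,
    ← integral_sub (hφ.mul_const _) (hφ.indicator hB), ← Real.norm_eq_abs]
  refine norm_integral_le_of_norm_le (hφ.indicator hS) (ae_of_all _ fun t => ?_)
  rw [hind, hind, ← mul_sub, norm_mul, Real.norm_of_nonneg (φ.nonneg_normed _), Real.norm_eq_abs]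
  by_cases ht : φ.normed μ (x - t) = 0
  · simp only [ht, zero_mul, le_refl]
  · have hdist : dist x t < φ.rOut := by
      rw [dist_eq_norm, ← mem_ball_zero_iff, ← φ.support_normed_eq (μ := μ)]
      exact ht
    exact mul_le_mul_of_nonneg_left (abs_indicator_closedBall_sub_le hdist) (φ.nonneg_normed _)

variable {φ} {ι : Type*} {x : ι → V} {g : ι → ℂ} {K : ℝ≥0}

theorem sum_setIntegral_normed_mul_norm_le (hK : ∀ t, ∑' i, ‖φ.normed μ (x i - t) • g i‖ₑ ≤ K)
    {A : Set V} (hA : μ A < ⊤) (s : Finset ι) :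
    ∑ i ∈ s, (∫ t in A, φ.normed μ (x i - t) ∂μ) * ‖g i‖ ≤ K * μ.real A := by
  have hint : ∀ i, IntegrableOn (fun t => φ.normed μ (x i - t) * ‖g i‖) A μ := fun i =>
    ((integrable_normed_sub φ (x i)).mul_const _).integrableOn
  have hle : ∀ t, ∑ i ∈ s, φ.normed μ (x i - t) * ‖g i‖ ≤ K := fun t => by
    have hsum : ∑ i ∈ s, ‖φ.normed μ (x i - t) • g i‖₊ ≤ K := by
      rw [← ENNReal.coe_le_coe, ENNReal.ofNNReal_finsetSum]
      exact (ENNReal.sum_le_tsum s).trans (hK t)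
    simpa [← NNReal.coe_le_coe, norm_smul, abs_of_nonneg (φ.nonneg_normed _)] using hsum
  calc ∑ i ∈ s, (∫ t in A, φ.normed μ (x i - t) ∂μ) * ‖g i‖
      = ∫ t in A, ∑ i ∈ s, φ.normed μ (x i - t) * ‖g i‖ ∂μ := by
        rw [integral_finsetSum _ fun i _ => hint i]
        simp only [integral_mul_const]
    _ ≤ ∫ _ in A, (K : ℝ) ∂μ :=
        integral_mono (integrable_finsetSum _ fun i _ => hint i) (integrableOn_const hA.ne) hle
    _ = K * μ.real A := by rw [setIntegral_const, smul_eq_mul, mul_comm]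

theorem summable_setIntegral_normed_mul_norm
    (hK : ∀ t, ∑' i, ‖φ.normed μ (x i - t) • g i‖ₑ ≤ K) {A : Set V} (hA : μ A < ⊤) :
    Summable fun i => (∫ t in A, φ.normed μ (x i - t) ∂μ) * ‖g i‖ :=
  summable_of_sum_le
    (fun i => mul_nonneg (setIntegral_normed_sub_nonneg φ (x i) A) (norm_nonneg _))
    (sum_setIntegral_normed_mul_norm_le hK hA)

theorem hasSum_setIntegral_normed_smul [Countable ι]
    (hK : ∀ t, ∑' i, ‖φ.normed μ (x i - t) • g i‖ₑ ≤ K) {A : Set V} (hA : μ A < ⊤) :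
    HasSum (fun i => (∫ t in A, φ.normed μ (x i - t) ∂μ) • g i)
      (∫ t in A, ∑' i, φ.normed μ (x i - t) • g i ∂μ) := by
  have hsum := hasSum_integral_of_summable_integral_norm (μ := μ.restrict A)
    (F := fun i t => φ.normed μ (x i - t) • g i)
    (fun i => ((integrable_normed_sub φ (x i)).smul_const _).integrableOn) <| by
      simpa only [norm_smul, Real.norm_of_nonneg (φ.nonneg_normed _), integral_mul_const]
        using summable_setIntegral_normed_mul_norm hK hA
  simpa only [integral_smul_const] using hsum

theorem norm_indicator_preimage_closedBall_sub_le (a : V) (r : ℝ) (i : ι) :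
    ‖(x ⁻¹' closedBall a r).indicator g i -
        (∫ t in closedBall a r, φ.normed μ (x i - t) ∂μ) • g i‖ ≤
      (∫ t in shell a r φ.rOut, φ.normed μ (x i - t) ∂μ) * ‖g i‖ := by
  have hg : (x ⁻¹' closedBall a r).indicator g i =
      (closedBall a r).indicator (1 : V → ℝ) (x i) • g i := by
    by_cases hi : x i ∈ closedBall a r <;> simp [Set.indicator, hi]
  rw [hg, ← sub_smul, norm_smul]
  exact mul_le_mul_of_nonneg_right (abs_indicator_closedBall_sub_setIntegral_le φ a (x i) r)
    (norm_nonneg _)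

variable [Countable ι]

theorem summable_preimage_closedBall (hK : ∀ t, ∑' i, ‖φ.normed μ (x i - t) • g i‖ₑ ≤ K) (a : V)
    (r : ℝ) : Summable fun i : x ⁻¹' closedBall a r => g i := by
  have hdiff := Summable.of_norm_bounded
    (summable_setIntegral_normed_mul_norm hK (measure_shell_lt_top a r φ.rOut))
    (norm_indicator_preimage_closedBall_sub_le (x := x) (g := g) a r)
  have hball := hasSum_setIntegral_normed_smul hK (measure_closedBall_lt_top (x := a) (r := r))
  refine summable_subtype_iff_indicator.2 ?_
  simpa only [sub_add_cancel] using hdiff.add hball.summable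

theorem norm_tsum_preimage_closedBall_sub_le
    (hK : ∀ t, ∑' i, ‖φ.normed μ (x i - t) • g i‖ₑ ≤ K) (a : V) (r : ℝ) :
    ‖∑' i : x ⁻¹' closedBall a r, g i -
        ∫ t in closedBall a r, ∑' i, φ.normed μ (x i - t) • g i ∂μ‖ ≤
      K * μ.real (shell a r φ.rOut) := by
  have hS : μ (shell a r φ.rOut) < ⊤ := measure_shell_lt_top a r φ.rOut
  have hdiff := (summable_subtype_iff_indicator.1 (summable_preimage_closedBall hK a r)).hasSum.sub
    (hasSum_setIntegral_normed_smul hK (measure_closedBall_lt_top (x := a) (r := r)))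
  have hbound := summable_setIntegral_normed_mul_norm hK hS
  rw [tsum_subtype, ← hdiff.tsum_eq]
  exact (tsum_of_norm_bounded hbound.hasSum (norm_indicator_preimage_closedBall_sub_le a r)).trans
    (hbound.tsum_le_of_sum_le (sum_setIntegral_normed_mul_norm_le hK hS))

theorem HasBallMean.tendsto_tsum_preimage_closedBall
    (hK : ∀ t, ∑' i, ‖φ.normed μ (x i - t) • g i‖ₑ ≤ K) {c : ℂ}
    (hc : HasBallMean μ (fun t => ∑' i, φ.normed μ (x i - t) • g i) c) (a : V) :
    Tendsto (fun r => (μ.real (closedBall (0 : V) r) : ℂ)⁻¹ * ∑' i : x ⁻¹' closedBall a r, g i)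
      atTop (𝓝 c) := by
  have hshell : Tendsto (fun r => K * (μ.real (shell a r φ.rOut) / μ.real (closedBall a r))) atTop
      (𝓝 0) := by
    simpa using (tendsto_measureReal_shell_div μ a φ.rOut_pos.le).const_mul (K : ℝ)
  refine (tendsto_iff_of_dist (squeeze_zero (fun _ => dist_nonneg) (fun r => ?_) hshell)).1 (hc a)
  rw [← Measure.addHaar_real_closedBall_center μ a, ← Complex.ofReal_inv, ← Complex.real_smul,
    setAverage_eq, dist_comm, dist_eq_norm, ← smul_sub, norm_smul, norm_inv,
    Real.norm_of_nonneg measureReal_nonneg, ← mul_div_assoc, div_eq_inv_mul]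
  gcongr
  exact norm_tsum_preimage_closedBall_sub_le hK a r

end Smoothing

section Assembly

variable {d m : ℕ}

instance : (volume : Measure (Euc d × Euc m)).IsAddHaarMeasure :=
  inferInstanceAs ((volume : Measure (Euc d)).prod (volume : Measure (Euc m))).IsAddHaarMeasure

/-- The functional `z ↦ y · z` for the Euclidean scalar product of `ℝᵈ × ℝᵐ`, identifying vectors
of the dual lattice with elements of `integralDual`. -/
def pairing (y : Euc d × Euc m) : StrongDual ℝ (Euc d × Euc m) :=
  (innerSL ℝ y.1).coprod (innerSL ℝ y.2)

theorem pairing_apply (y z : Euc d × Euc m) :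
    pairing y z = inner ℝ y.1 z.1 + inner ℝ y.2 z.2 :=
  rfl

theorem pairing_comp_inl (y : Euc d × Euc m) :
    (pairing y).comp (ContinuousLinearMap.inl ℝ (Euc d) (Euc m)) = innerSL ℝ y.1 :=
  ContinuousLinearMap.coprod_comp_inl _ _

theorem pairing_surjective : Function.Surjective (pairing (d := d) (m := m)) := fun ξ =>
  ⟨((InnerProductSpace.toDual ℝ (Euc d)).symm (ξ.comp (.inl ℝ _ _)),
    (InnerProductSpace.toDual ℝ (Euc m)).symm (ξ.comp (.inr ℝ _ _))), by
    ext z <;> simp [pairing]⟩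

variable {Λ : Submodule ℤ (Euc d × Euc m)}

theorem pairing_mem_integralDual_iff {y : Euc d × Euc m} :
    pairing y ∈ integralDual Λ ↔ y ∈ dualLattice Λ :=
  Iff.rfl

theorem comp_inl_eq_innerSL_iff (hdense : Dense (Prod.snd '' (Λ : Set (Euc d × Euc m))))
    {y : Euc d × Euc m} (hy : y ∈ dualLattice Λ) {ξ : StrongDual ℝ (Euc d × Euc m)}
    (hξ : ξ ∈ integralDual Λ) :
    ξ.comp (ContinuousLinearMap.inl ℝ _ _) = innerSL ℝ y.1 ↔ ξ = pairing y := by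
  obtain ⟨z, rfl⟩ := pairing_surjective ξ
  refine ⟨fun h => ?_, fun h => h ▸ pairing_comp_inl y⟩
  rw [pairing_comp_inl, innerSL_inj] at h
  rw [injOn_fst_dualLattice hdense (pairing_mem_integralDual_iff.1 hξ) hy h]

theorem comp_inl_ne_innerSL {k : Euc d} (hk : k ∉ directModule (dualLattice Λ))
    {ξ : StrongDual ℝ (Euc d × Euc m)} (hξ : ξ ∈ integralDual Λ) :
    ξ.comp (ContinuousLinearMap.inl ℝ _ _) ≠ innerSL ℝ k := by
  obtain ⟨z, rfl⟩ := pairing_surjective ξ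
  rw [pairing_comp_inl, Ne, innerSL_inj]
  rintro rfl
  exact hk (Submodule.mem_map_of_mem (f := LinearMap.fst ℤ _ _)
    (pairing_mem_integralDual_iff.1 hξ))

/-- When `π₁` is one-to-one on `Λ`, its image is parametrised by `Λ`. -/
def latticeEquiv (hinj : Set.InjOn Prod.fst (Λ : Set (Euc d × Euc m))) : directModule Λ ≃ Λ where
  toFun x := ⟨(x, starMap Λ x), mk_starMap_mem Λ x⟩
  invFun l := ⟨l.1.1, Submodule.mem_map_of_mem (f := LinearMap.fst ℤ _ _) l.2⟩
  left_inv _ := rfl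
  right_inv l := Subtype.ext (hinj (mk_starMap_mem Λ _) l.2 rfl)

/-- The function `(x, u) ↦ e^{-2πi k·x} φ(x) f(u)` on `ℝᵈ × ℝᵐ`, whose sum over a translate of `Λ`
along `ℝᵈ` is a smoothed count of the terms `bohrTerm Λ f k`. -/
def smoothedTerm (φ : ContDiffBump (0 : Euc d)) (f : Euc m → ℂ) (k : Euc d)
    (z : Euc d × Euc m) : ℂ :=
  expChar (-innerSL ℝ k) z.1 * φ.normed volume z.1 * f z.2

variable (φ : ContDiffBump (0 : Euc d)) {f : Euc m → ℂ} (k : Euc d)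

theorem isWiener_smoothedTerm (hf : IsWiener volume f) :
    IsWiener volume (smoothedTerm φ f k) := by
  have hφ : Continuous fun s => (φ.normed volume s : ℂ) :=
    Complex.continuous_ofReal.comp φ.continuous_normed
  have hsupp : HasCompactSupport fun s => (φ.normed volume s : ℂ) :=
    φ.hasCompactSupport_normed.comp_left Complex.ofReal_zero
  rw [Measure.volume_eq_prod]
  exact (isWiener_of_hasCompactSupport ((expChar (-innerSL ℝ k)).continuous.mul hφ)
    hsupp.mul_left).mul_prod hf

theorem normed_smul_bohrTerm (hinj : Set.InjOn Prod.fst (Λ : Set (Euc d × Euc m)))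
    (x : directModule Λ) (t : Euc d) :
    φ.normed volume ((x : Euc d) - t) • bohrTerm Λ f k x =
      expChar (-innerSL ℝ k) t *
        smoothedTerm φ f k ((latticeEquiv hinj x : Euc d × Euc m) - (t, 0)) := by
  have hexp : Complex.exp (-(2 * Real.pi * Complex.I * (inner ℝ k (x : Euc d) : ℝ))) =
      expChar (-innerSL ℝ k) (x : Euc d) := by
    rw [← map_neg, expChar_innerSL_apply, inner_neg_left, Complex.ofReal_neg, mul_neg]
  have hmul := expChar_apply_add (-innerSL ℝ k) t (x - t)
  rw [add_sub_cancel] at hmul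
  rw [bohrTerm, smoothedTerm, hexp, hmul, Complex.real_smul]
  simp only [latticeEquiv, Equiv.coe_fn_mk, Prod.fst_sub, Prod.snd_sub, sub_zero]
  ring

theorem fourier_neg_eq_integral_expChar_innerSL (f : Euc m → ℂ) (y : Euc m) :
    𝓕 f (-y) = ∫ u, expChar (innerSL ℝ y) u * f u := by
  simp only [Real.fourier_eq, inner_neg_right, neg_neg, real_inner_comm]
  rfl

theorem fourier_neg_eq_integral_exp (f : Euc m → ℂ) (y : Euc m) :
    𝓕 f (-y) = ∫ u, Complex.exp (2 * Real.pi * Complex.I * (inner ℝ y u : ℝ)) * f u := by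
  simp only [fourier_neg_eq_integral_expChar_innerSL, expChar_innerSL_apply]

theorem integral_expChar_pairing_mul_smoothedTerm (f : Euc m → ℂ) (y : Euc d × Euc m) :
    ∫ z, expChar (pairing y) z * smoothedTerm φ f y.1 z = 𝓕 f (-y.2) := by
  have hsplit : ∀ z, expChar (pairing y) z * smoothedTerm φ f y.1 z =
      (φ.normed volume z.1 : ℂ) * (expChar (innerSL ℝ y.2) z.2 * f z.2) := fun z => by
    have hchar : expChar (pairing y) z =
        expChar (innerSL ℝ y.1) z.1 * expChar (innerSL ℝ y.2) z.2 := by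
      simp [expChar_apply, pairing_apply, AddChar.map_add_eq_mul]
    have hcancel : expChar (innerSL ℝ y.1) z.1 * expChar (-innerSL ℝ y.1) z.1 = 1 := by
      rw [← BoundedContinuousFunction.mul_apply, ← expChar_add, add_neg_cancel, expChar_zero]
      rfl
    rw [hchar, smoothedTerm]
    linear_combination φ.normed volume z.1 * expChar (innerSL ℝ y.2) z.2 * f z.2 * hcancel
  simp only [hsplit]
  rw [Measure.volume_eq_prod, integral_prod_mul (fun s => (φ.normed volume s : ℂ))
    (fun u => expChar (innerSL ℝ y.2) u * f u), integral_complex_ofReal, φ.integral_normed,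
    Complex.ofReal_one, one_mul, fourier_neg_eq_integral_expChar_innerSL]

variable [DiscreteTopology Λ] [IsZLattice ℝ Λ]

theorem tsum_normed_smul_bohrTerm (hinj : Set.InjOn Prod.fst (Λ : Set (Euc d × Euc m)))
    (hf : IsWiener volume f) (t : Euc d) :
    ∑' x : directModule Λ, φ.normed volume ((x : Euc d) - t) • bohrTerm Λ f k x =
      expChar (-innerSL ℝ k) t * (isWiener_smoothedTerm φ k hf).periodization Λ (t, 0) := by
  simp only [normed_smul_bohrTerm φ k hinj, tsum_mul_left]
  rw [IsWiener.periodization_apply, ← (latticeEquiv hinj).tsum_eq]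

theorem exists_tsum_enorm_normed_smul_bohrTerm_le
    (hinj : Set.InjOn Prod.fst (Λ : Set (Euc d × Euc m))) (hf : IsWiener volume f) :
    ∃ K : ℝ≥0, ∀ t : Euc d,
      ∑' x : directModule Λ, ‖φ.normed volume ((x : Euc d) - t) • bohrTerm Λ f k x‖ₑ ≤ K := by
  obtain ⟨K, hK⟩ := (isWiener_smoothedTerm φ k hf).exists_tsum_enorm_le Λ
  refine ⟨K, fun t => ?_⟩
  have henorm : ‖expChar (-innerSL ℝ k) t‖ₑ = 1 := by
    rw [← ofReal_norm, norm_expChar_apply, ENNReal.ofReal_one]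
  simp only [normed_smul_bohrTerm φ k hinj, enorm_mul, henorm, one_mul]
  rw [(latticeEquiv hinj).tsum_eq fun l : Λ => ‖smoothedTerm φ f k (l.1 - (t, 0))‖ₑ]
  exact hK (t, 0)

theorem countable_directModule (hinj : Set.InjOn Prod.fst (Λ : Set (Euc d × Euc m))) :
    Countable (directModule Λ) :=
  (latticeEquiv hinj).countable_iff.2 inferInstance

theorem summable_bohrTerm (hinj : Set.InjOn Prod.fst (Λ : Set (Euc d × Euc m)))
    (hf : IsWiener volume f) (a : Euc d) (r : ℝ) :
    Summable fun x : pointsInBall Λ a r => bohrTerm Λ f k x := by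
  have := countable_directModule hinj
  obtain ⟨K, hK⟩ := exists_tsum_enorm_normed_smul_bohrTerm_le
    (⟨1, 2, one_pos, one_lt_two⟩ : ContDiffBump (0 : Euc d)) k hinj hf
  exact summable_preimage_closedBall hK a r

open Classical in
theorem tendsto_bohrApprox (hinj : Set.InjOn Prod.fst (Λ : Set (Euc d × Euc m)))
    (hf : IsWiener volume f) {Φ : (Euc d × Euc m →ᵇ ℂ) →L[ℂ] ℂ}
    (hΦ : ∀ ξ ∈ integralDual Λ, Φ (expChar ξ) =
      if ξ.comp (ContinuousLinearMap.inl ℝ _ _) = innerSL ℝ k then 1 else 0) (a : Euc d) :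
    Tendsto (bohrApprox Λ f k a) atTop
      (𝓝 (Φ ((isWiener_smoothedTerm φ k hf).periodization Λ))) := by
  have := countable_directModule hinj
  obtain ⟨K, hK⟩ := exists_tsum_enorm_normed_smul_bohrTerm_le φ k hinj hf
  have hmean := hasBallMean_expChar_mul_comp (μ := volume) _ _ hΦ
    (isWiener_smoothedTerm φ k hf).periodization_add
  refine HasBallMean.tendsto_tsum_preimage_closedBall hK ?_ a
  simpa only [tsum_normed_smul_bohrTerm φ k hinj hf, ContinuousLinearMap.inl_apply] using hmean

theorem tendsto_bohrApprox_of_mem_dualLattice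
    (hinj : Set.InjOn Prod.fst (Λ : Set (Euc d × Euc m)))
    (hdense : Dense (Prod.snd '' (Λ : Set (Euc d × Euc m)))) (hf : IsWiener volume f)
    {y : Euc d × Euc m} (hy : y ∈ dualLattice Λ) (a : Euc d) :
    Tendsto (bohrApprox Λ f y.1 a) atTop (𝓝 ((ZLattice.covolume Λ : ℂ)⁻¹ * 𝓕 f (-y.2))) := by
  classical
  set φ : ContDiffBump (0 : Euc d) := ⟨1, 2, one_pos, one_lt_two⟩
  rw [← integral_expChar_pairing_mul_smoothedTerm φ, ←
    (isWiener_smoothedTerm φ y.1 hf).fourierCoeffCLM_periodization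
      (pairing_mem_integralDual_iff.2 hy)]
  refine tendsto_bohrApprox φ y.1 hinj hf (fun ξ hξ => ?_) a
  exact (fourierCoeffCLM_expChar (pairing_mem_integralDual_iff.2 hy) hξ).trans
    (if_congr (comp_inl_eq_innerSL_iff hdense hy hξ).symm rfl rfl)

theorem tendsto_bohrApprox_of_notMem (hinj : Set.InjOn Prod.fst (Λ : Set (Euc d × Euc m)))
    (hf : IsWiener volume f) {k : Euc d} (hk : k ∉ directModule (dualLattice Λ)) (a : Euc d) :
    Tendsto (bohrApprox Λ f k a) atTop (𝓝 0) :=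
  tendsto_bohrApprox ⟨1, 2, one_pos, one_lt_two⟩ k hinj hf (Φ := 0)
    (fun ξ hξ => by simp [comp_inl_ne_innerSL hk hξ]) a

end Assembly

end CutProject

end

open CutProject in
theorem theorem3p3_general {d m : ℕ}
    (Λ : Submodule ℤ (Euc d × Euc m))
    [DiscreteTopology Λ] [IsZLattice ℝ Λ]
    (hinj₁ : Set.InjOn Prod.fst (Λ : Set (Euc d × Euc m)))
    (hdense₂ : Dense (Prod.snd '' (Λ : Set (Euc d × Euc m))))
    {f : Euc m → ℂ} (hf : IsWiener volume f) :
    Integrable f ∧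
    ∀ k : Euc d,
      (∀ (a : Euc d) (r : ℝ),
        Summable fun x : pointsInBall Λ a r => bohrTerm Λ f k x) ∧
      ∃ c : ℂ,
        (∀ a : Euc d,
          Tendsto (fun r : ℝ => bohrApprox Λ f k a r) atTop (𝓝 c)) ∧
        (∀ hk : k ∈ directModule (dualLattice Λ),
          c = ((ZLattice.covolume Λ : ℝ) : ℂ)⁻¹ *
              ∫ u : Euc m,
                Complex.exp (2 * Real.pi * Complex.I *
                  (inner ℝ (starMap (dualLattice Λ) ⟨k, hk⟩) u : ℝ)) *
                  f u ∧
          c = ((ZLattice.covolume Λ : ℝ) : ℂ)⁻¹ *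
              𝓕 f (-starMap (dualLattice Λ) ⟨k, hk⟩)) ∧
        (k ∉ directModule (dualLattice Λ) → c = 0) := by
  refine ⟨hf.integrable, fun k => ⟨summable_bohrTerm k hinj₁ hf, ?_⟩⟩
  by_cases hk : k ∈ directModule (dualLattice Λ)
  · have hlim := tendsto_bohrApprox_of_mem_dualLattice hinj₁ hdense₂ hf
      (mk_starMap_mem (dualLattice Λ) ⟨k, hk⟩)
    exact ⟨_, hlim, fun _ => ⟨by rw [fourier_neg_eq_integral_exp], rfl⟩, fun h => absurd hk h⟩
  · exact ⟨0, tendsto_bohrApprox_of_notMem hinj₁ hf hk, fun h => absurd h hk, fun _ => rfl⟩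

theorem theorem3p3 {d m : ℕ}
    (Λ : Submodule ℤ (CutProject.Euc d × CutProject.Euc m))
    [DiscreteTopology Λ] [IsZLattice ℝ Λ]
    (hinj₁ : Set.InjOn Prod.fst (Λ : Set (CutProject.Euc d × CutProject.Euc m)))
    (hinj₂ : Set.InjOn Prod.snd (Λ : Set (CutProject.Euc d × CutProject.Euc m)))
    (hdense₁ : Dense (Prod.fst '' (Λ : Set (CutProject.Euc d × CutProject.Euc m))))
    (hdense₂ : Dense (Prod.snd '' (Λ : Set (CutProject.Euc d × CutProject.Euc m))))
    (f : CutProject.Euc m → ℂ) (hf : Continuous f)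
    (C α : ℝ) (hC : 0 < C) (hα : 0 < α)
    (hdecay : ∀ x : CutProject.Euc m, ‖x‖ ^ ((m : ℝ) + 1 + α) * ‖f x‖ ≤ C) :
    Integrable f ∧
    ∀ k : CutProject.Euc d,
      (∀ (a : CutProject.Euc d) (r : ℝ),
        Summable fun x : CutProject.pointsInBall Λ a r => CutProject.bohrTerm Λ f k x) ∧
      ∃ c : ℂ,
        (∀ a : CutProject.Euc d,
          Tendsto (fun r : ℝ => CutProject.bohrApprox Λ f k a r) atTop (𝓝 c)) ∧
        (∀ hk : k ∈ CutProject.directModule (CutProject.dualLattice Λ),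
          c = ((ZLattice.covolume Λ : ℝ) : ℂ)⁻¹ *
              ∫ u : CutProject.Euc m,
                Complex.exp (2 * Real.pi * Complex.I *
                  (inner ℝ (CutProject.starMap (CutProject.dualLattice Λ) ⟨k, hk⟩) u : ℝ)) *
                  f u ∧
          c = ((ZLattice.covolume Λ : ℝ) : ℂ)⁻¹ *
              𝓕 f (-CutProject.starMap (CutProject.dualLattice Λ) ⟨k, hk⟩)) ∧
        (k ∉ CutProject.directModule (CutProject.dualLattice Λ) → c = 0) :=
  theorem3p3_general Λ hinj₁ hdense₂
    (CutProject.isWiener_of_decay hf (by rw [finrank_euclideanSpace_fin]; linarith) hdecay)
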